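/- A cyclic order on a set $G$ is a ternary relation $C$ on $G$ such that for all $a,b,c,d\in G$: $C(a,b,c)$ implies $C(b,c,a)$; $C(a,b,c)$ implies $\neg C(c,b,a)$; $C(a,b,c)$ and $C(a,c,d)$ imply $C(a,b,d)$; and if $a,b,c$ are distinct then $C(a,b,c)$ or $C(c,b,a)$. A cyclic order on an abelian group is additive if $C(a,b,c)$ implies $C(a+g,b+g,c+g)$ for all $g$. For $\alpha\in\mathbb{R}\setminus\mathbb{Q}$ let $C_\alpha$ be the relation on $\mathbb{Z}$ such that $C_\alpha(j,k,l)$ holds if and only if the fractional parts $x,y,z\in[0,1)$ of $\alpha j,\alpha k,\alpha l$ satisfy $x<y<z$ or $y<z<x$ or $z<x<y$; that is, $C_\alpha$ is the pull-back of the positive cyclic order of $\mathbb{R}/\mathbb{Z}$ along $l\mapsto\alpha l+\mathbb{Z}$. "Definable" means first-order definable with parameters. Two structures on the same underlying set $M$ are definably equivalent if they define the same subsets of $M^n$ for every $n$, and definably distinct otherwise. A theory is dp-minimal if in no model $N$ of it are there formulas $\varphi(x;y)$, $\psi(x;z)$ with $x$ a single variable and $y,z$ finite tuples of variables, and tuples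 $(a_k)_{k\in\mathbb{N}}$, $(b_k)_{k\in\mathbb{N}}$ from $N$, such that for all $i,j\in\mathbb{N}$ some $x\in N$ satisfies, for every $k$, $\varphi(x;a_k)$ if and only if $k=i$, and $\psi(x;b_k)$ if and only if $k=j$. A structure is dp-minimal if its complete theory is. **Corollary 3.7.** There is a set $A\subseteq\mathbb{R}\setminus\mathbb{Q}$ of cardinality $2^{\aleph_0}$ such that for every $\alpha\in A$ the relation $C_\alpha$ is an additive cyclic order on $\mathbb{Z}$ and the structure $(\mathbb{Z};+,C_\alpha)$ is dp-minimal, and such that for all distinct $\alpha,\beta\in A$ the structures $(\mathbb{Z};+,C_\alpha)$ and $(\mathbb{Z};+,C_\beta)$ are definably distinct; indeed, the collection of subsets of $\mathbb{Z}$ definable in $(\mathbb{Z};+,C_\alpha)$ differs from the collection of subsets of $\mathbb{Z}$ definable in $(\mathbb{Z};+,C_\beta)$. -/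

import Mathlib

open scoped Cardinal
open scoped FirstOrder

universe u v

/-- `C` is a cyclic order on `G`. -/
structure IsCyclicOrder {G : Type*} (C : G → G → G → Prop) : Prop where
  cyclic : ∀ a b c, C a b c → C b c a
  asymm : ∀ a b c, C a b c → ¬ C c b a
  trans : ∀ a b c d, C a b c → C a c d → C a b d
  total : ∀ a b c, a ≠ b → b ≠ c → a ≠ c → C a b c ∨ C c b a

/-- A cyclic order on an abelian group that is preserved by the group operation. -/
structure IsAdditiveCyclicOrder {G : Type*} [AddCommGroup G] (C : G → G → G → Prop) : Prop
    extends IsCyclicOrder C where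
  add_right : ∀ a b c g, C a b c → C (a + g) (b + g) (c + g)

/-- The cyclic order of the positively oriented circle `ℝ / ℤ`, expressed for real representatives:
the representatives in `[0, 1)` of `x`, `y`, `z` satisfy `x < y < z` up to a cyclic rotation. -/
def circleCyclic (x y z : ℝ) : Prop :=
  (Int.fract x < Int.fract y ∧ Int.fract y < Int.fract z) ∨
  (Int.fract y < Int.fract z ∧ Int.fract z < Int.fract x) ∨
  (Int.fract z < Int.fract x ∧ Int.fract x < Int.fract y)

/-- The relation `C_α` on `ℤ`: the pull-back of the cyclic order of the positively oriented circle
by the character `l ↦ α l + ℤ`. -/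
def cyclicOrderOf (α : ℝ) (j k l : ℤ) : Prop :=
  circleCyclic (α * j) (α * k) (α * l)

/-- Function symbols: one binary symbol `+`. -/
inductive CycGroupFunc : ℕ → Type
  | add : CycGroupFunc 2

/-- Relation symbols: one ternary symbol `C`. -/
inductive CycGroupRel : ℕ → Type
  | cyc : CycGroupRel 3

/-- The language `{+, C}` of cyclically ordered groups. -/
def cycGroupLang : FirstOrder.Language.{0, 0} where
  Functions := CycGroupFunc
  Relations := CycGroupRel

/-- The structure `(ℤ; +, C)`. -/
@[reducible] def intCycStructure (C : ℤ → ℤ → ℤ → Prop) : cycGroupLang.Structure ℤ where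
  funMap := fun {_} f v => match f, v with
    | CycGroupFunc.add, v => v 0 + v 1
  RelMap := fun {_} r v => match r, v with
    | CycGroupRel.cyc, v => C (v 0) (v 1) (v 2)

/-- `X ⊆ ℤ ^ n` is definable (with parameters) in `(ℤ; +, C)`. -/
def DefinableIn (C : ℤ → ℤ → ℤ → Prop) {n : ℕ} (X : Set (Fin n → ℤ)) : Prop :=
  letI := intCycStructure C
  (Set.univ : Set ℤ).Definable cycGroupLang X

/-- The collection of the subsets of `ℤ` definable (with parameters) in `(ℤ; +, C)`. -/
def definableSubsets (C : ℤ → ℤ → ℤ → Prop) : Set (Set ℤ) :=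
  letI := intCycStructure C
  {X | (Set.univ : Set ℤ).Definable₁ cycGroupLang X}

/-- `(ℤ; +, C)` is a reduct of `(ℤ; +, C')`: every set definable in the former is definable in the
latter. -/
def IsReduct (C C' : ℤ → ℤ → ℤ → Prop) : Prop :=
  ∀ (n : ℕ) (X : Set (Fin n → ℤ)), DefinableIn C X → DefinableIn C' X

/-- `(ℤ; +, C)` and `(ℤ; +, C')` are definably equivalent: each is a reduct of the other. -/
def DefinablyEquivalent (C C' : ℤ → ℤ → ℤ → Prop) : Prop :=
  IsReduct C C' ∧ IsReduct C' C

/-- The formulas `φ(x; y)` and `ψ(x; z)`, with `x` a single variable and `y`, `z` tuples, form an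
ict-pattern of depth two in `N`: there are tuples `a k` and `b k` such that for all `i`, `j` some
element `x` satisfies exactly the `i`-th instance of `φ` and exactly the `j`-th instance of `ψ`. -/
def HasIctPattern {L : FirstOrder.Language} (N : Type*) [L.Structure N] {m n : ℕ}
    (φ : L.Formula (Unit ⊕ Fin m)) (ψ : L.Formula (Unit ⊕ Fin n)) : Prop :=
  ∃ (a : ℕ → Fin m → N) (b : ℕ → Fin n → N), ∀ i j : ℕ, ∃ x : N,
    (∀ k, φ.Realize (Sum.elim (fun _ => x) (a k)) ↔ k = i) ∧
    (∀ k, ψ.Realize (Sum.elim (fun _ => x) (b k)) ↔ k = j)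

/-- A theory is dp-minimal if no model of it has an ict-pattern of depth two in a single variable.
By the downward Löwenheim-Skolem theorem it is enough to look at the models in one universe that
contains the language. -/
def IsDPMinimal {L : FirstOrder.Language.{u, v}} (T : L.Theory) : Prop :=
  ∀ (N : Type (max u v)) [L.Structure N], N ⊨ T →
    ∀ (m n : ℕ) (φ : L.Formula (Unit ⊕ Fin m)) (ψ : L.Formula (Unit ⊕ Fin n)),
      ¬ HasIctPattern N φ ψ

/-- The complete first-order theory of `(ℤ; +, C)`. -/
def intCycTheory (C : ℤ → ℤ → ℤ → Prop) : cycGroupLang.Theory :=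
  letI := intCycStructure C
  cycGroupLang.completeTheory ℤ

/-! Dp-minimality. View `x` through `Int.fract (α * x)`, which is injective on the integers. A
back-and-forth argument shows that the truth of a formula at a tuple depends only on the residues of
the `x i` and of the `⌊α * x i⌋` modulo some `m`, together with the signs of finitely many integral
affine forms in the fractional parts (`FractSim`, `exists_fractSim_realize_iff`). The extension
step, `FractSim.exists_extension`, either solves a linear equation exactly, using the residues, or
uses density of the fractional parts within residue classes. Hence an instance of a formula in one
variable is, on each of finitely many residue classes, cut out by boundary points whose number is
bounded independently of the parameters. Since `n + n` such sets cut the line into only `O(n)`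
cells, they cannot separate the `n * n` points of a large grid (`sq_le_of_hasBoundary`). A finite
grid is expressed by a sentence, so no model of the theory has an infinite one.

Distinctness. The definable set `doublingSet α` tells for each `k` whether the fractional part of `2
^ k * α` is below `1 / 2`, that is, it gives the binary digits of `α`; so it determines an
irrational `α` in the unit interval. One structure has only countably many definable subsets of `ℤ`,
so only countably many such `α` share the same collection. As there are continuum many `α`, there
are continuum many collections, and `A` picks one `α` for each. -/

/-! ### Affine forms in fractional parts and similarity of tuples -/

/-- The value at `x` of the affine form with coefficients `c` and constant term `d` in the
fractional parts of `α * x i`. -/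
noncomputable def fractForm (α : ℝ) {ι : Type*} [Fintype ι] (c : ι → ℤ) (d : ℤ) (x : ι → ℤ) : ℝ :=
  ∑ i, (c i : ℝ) * Int.fract (α * x i) + d

/-- The tuples `x` and `y` agree modulo `m` and give the same sign to all affine forms in the
fractional parts of `α * x i` whose coefficients are bounded by `N`. -/
structure FractSim (α : ℝ) {ι : Type*} [Fintype ι] (N m : ℕ) (x y : ι → ℤ) : Prop where
  modEq : ∀ i, x i ≡ y i [ZMOD m]
  floor_modEq : ∀ i, ⌊α * x i⌋ ≡ ⌊α * y i⌋ [ZMOD m]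
  sign_eq : ∀ (c : ι → ℤ) (d : ℤ), (∀ i, |c i| ≤ N) → |d| ≤ N →
    SignType.sign (fractForm α c d x) = SignType.sign (fractForm α c d y)

theorem sign_eq_iff_lt_and_lt {a b : ℝ} :
    SignType.sign a = SignType.sign b ↔ ((0 < a ↔ 0 < b) ∧ (a < 0 ↔ b < 0)) := by
  rcases lt_trichotomy a 0 with ha | ha | ha <;> rcases lt_trichotomy b 0 with hb | hb | hb <;>
    simp [ha, hb, ha.not_gt, hb.not_gt, sign_pos, sign_neg] 

section

variable {α : ℝ} {ι : Type*} [Fintype ι]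

theorem fractForm_lin (p q : ℤ) (c c' : ι → ℤ) (d d' : ℤ) (x : ι → ℤ) :
    fractForm α (fun i => p * c i + q * c' i) (p * d + q * d') x =
      p * fractForm α c d x + q * fractForm α c' d' x := by
  simp only [fractForm, mul_add, Finset.mul_sum]
  push_cast
  have : ∀ i, ((p : ℝ) * c i + q * c' i) * Int.fract (α * x i) =
      p * (c i * Int.fract (α * x i)) + q * (c' i * Int.fract (α * x i)) := fun i => by ring
  simp only [this, Finset.sum_add_distrib]
  ring

theorem FractSim.mono {N N' m m' : ℕ} {x y : ι → ℤ} (h : FractSim α N' m' x y) (hN : N ≤ N')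
    (hm : m ∣ m') : FractSim α N m x y where
  modEq i := (h.modEq i).of_dvd (Int.natCast_dvd_natCast.2 hm)
  floor_modEq i := (h.floor_modEq i).of_dvd (Int.natCast_dvd_natCast.2 hm)
  sign_eq c d hc hd := h.sign_eq c d (fun i => (hc i).trans (by exact_mod_cast hN))
    (hd.trans (by exact_mod_cast hN))

theorem FractSim.symm {N m : ℕ} {x y : ι → ℤ} (h : FractSim α N m x y) : FractSim α N m y x where
  modEq i := (h.modEq i).symm
  floor_modEq i := (h.floor_modEq i).symm
  sign_eq c d hc hd := (h.sign_eq c d hc hd).symm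

/-! ### Density and linear equations with prescribed residues -/

theorem fract_mul_intCast_injective (hα : Irrational α) {x y : ℤ}
    (h : Int.fract (α * x) = Int.fract (α * y)) : x = y := by
  by_contra hne
  obtain ⟨z, hz⟩ := Int.fract_eq_fract.1 h
  have : Irrational (α * ((x - y : ℤ) : ℝ)) := hα.mul_intCast (sub_ne_zero.2 hne)
  refine this.ne_int z ?_
  push_cast
  linarith

/-- The fractional part of `α * w` is dense even when the residues of `w` and of the integral part
of `α * w` are prescribed. -/
theorem exists_fract_mem_Ioo (hα : Irrational α) {m : ℕ} (hm : 0 < m) (z : ℤ) {a b : ℝ}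
    (ha : 0 ≤ a) (hb : b ≤ 1) (hab : a < b) :
    ∃ w : ℤ, w ≡ z [ZMOD m] ∧ ⌊α * w⌋ ≡ ⌊α * z⌋ [ZMOD m] ∧
      a < Int.fract (α * w) ∧ Int.fract (α * w) < b := by
  have hd : Dense (AddSubgroup.closure {1, α} : Set ℝ) :=
    dense_addSubgroupClosure_pair_iff.2 (by simpa using hα)
  have hm' : (0 : ℝ) < m := by exact_mod_cast hm
  -- With `g = p + q * α`, passing from `z` to `z + m * q` and lowering the integral part by `m * p`
  -- moves the fractional part by `m * g` and keeps both residues; hence the shifted and rescaled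
  -- target interval.
  obtain ⟨g, hg, hgm⟩ := hd.exists_between
    (show (a - Int.fract (α * z)) / m < (b - Int.fract (α * z)) / m by gcongr)
  obtain ⟨p, q, rfl⟩ := AddSubgroup.mem_closure_pair.1 hg
  rw [Set.mem_Ioo, div_lt_iff₀ hm', lt_div_iff₀ hm'] at hgm
  simp only [zsmul_eq_mul, mul_one] at hgm
  have key : α * ((z + m * q : ℤ) : ℝ) - ((⌊α * z⌋ - m * p : ℤ) : ℝ) =
      (p + q * α) * m + Int.fract (α * z) := by
    rw [Int.fract]; push_cast; ring
  have hfl : ⌊α * ((z + m * q : ℤ) : ℝ)⌋ = ⌊α * z⌋ - m * p := by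
    rw [Int.floor_eq_iff]
    constructor <;> linarith
  refine ⟨z + m * q, by simp [Int.ModEq], ?_, ?_⟩
  · rw [hfl]; simp [Int.ModEq, Int.sub_emod]
  · rw [Int.fract, hfl, key]
    constructor <;> linarith

/-- Splits the form as `α` times an integer minus an integer, so that irrationality turns its
vanishing into two integer equations. -/
theorem fractForm_eq (c : ι → ℤ) (d : ℤ) (x : ι → ℤ) :
    fractForm α c d x =
      α * ((∑ i, c i * x i : ℤ) : ℝ) - ((∑ i, c i * ⌊α * x i⌋ - d : ℤ) : ℝ) := by
  simp only [fractForm, Int.fract]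
  push_cast
  rw [Finset.mul_sum, ← sub_add, ← Finset.sum_sub_distrib]
  congr 1
  exact Finset.sum_congr rfl fun i _ => by ring

theorem sum_mul_modEq {n : ℤ} (c : ι → ℤ) {x y : ι → ℤ} (h : ∀ i, x i ≡ y i [ZMOD n]) :
    ∑ i, c i * x i ≡ ∑ i, c i * y i [ZMOD n] := by
  rw [Int.modEq_iff_dvd, ← Finset.sum_sub_distrib]
  refine Finset.dvd_sum fun i _ => ?_
  rw [← mul_sub]
  exact Dvd.dvd.mul_left (h i).dvd _

/-- Congruence modulo `e * m`, rather than `m`, survives division by `e`. -/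
theorem exists_eq_of_modEq_mul {e m A A' z : ℤ} (h : e * z + A = 0)
    (hA : A ≡ A' [ZMOD e * m]) : ∃ w, e * w + A' = 0 ∧ z ≡ w [ZMOD m] := by
  obtain ⟨k, hk⟩ := hA.dvd
  refine ⟨z - m * k, by linear_combination h + hk, ?_⟩
  rw [Int.modEq_iff_dvd]
  exact ⟨-k, by ring⟩

/-- A solution of a linear equation over `x` is transferred to the same equation over `y`. -/
theorem exists_solution_of_modEq (hα : Irrational α) {m : ℕ} {e : ℤ} (he : 0 < e)
    {x y : ι → ℤ} (h : ∀ i, x i ≡ y i [ZMOD e * m])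
    (hf : ∀ i, ⌊α * x i⌋ ≡ ⌊α * y i⌋ [ZMOD e * m]) {z : ℤ} {c : ι → ℤ} {d : ℤ}
    (hz : e * Int.fract (α * z) + fractForm α c d x = 0)
    (h0 : fractForm α c d y ≤ 0) (h1 : 0 < e + fractForm α c d y) :
    ∃ w : ℤ, z ≡ w [ZMOD m] ∧ ⌊α * z⌋ ≡ ⌊α * w⌋ [ZMOD m] ∧
      e * Int.fract (α * w) + fractForm α c d y = 0 := by
  have he' : (0 : ℝ) < e := by exact_mod_cast he
  rw [fractForm_eq] at h0 h1 hz ⊢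
  have hA := sum_mul_modEq c h
  have hB := (sum_mul_modEq c hf).sub_right d
  set A := ∑ i, c i * x i
  set A' := ∑ i, c i * y i
  set B := ∑ i, c i * ⌊α * x i⌋ - d
  set B' := ∑ i, c i * ⌊α * y i⌋ - d
  have hz' : α * ((e * z + A : ℤ) : ℝ) = ((e * ⌊α * z⌋ + B : ℤ) : ℝ) := by
    rw [Int.fract] at hz
    push_cast
    linear_combination hz
  have hzA : e * z + A = 0 := by
    by_contra hne
    exact (hα.mul_intCast hne).ne_int _ hz'
  have hzB : e * ⌊α * z⌋ + B = 0 := by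
    rw [hzA] at hz'
    have : (e : ℝ) * ⌊α * z⌋ + B = 0 := by simpa using hz'.symm
    exact_mod_cast this
  obtain ⟨w, hw, hwz⟩ := exists_eq_of_modEq_mul hzA hA
  obtain ⟨f, hf, hfz⟩ := exists_eq_of_modEq_mul hzB hB
  have hwR : (e : ℝ) * w + A' = 0 := by exact_mod_cast hw
  have hfR : (e : ℝ) * f + B' = 0 := by exact_mod_cast hf
  have key : α * A' - B' = -(e * (α * w - f)) := by linear_combination α * hwR - hfR
  rw [key] at h0 h1
  -- The sign hypotheses `h0` and `h1` now say `0 ≤ α * w - f < 1`.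
  have hfl : ⌊α * w⌋ = f := by
    rw [Int.floor_eq_iff]
    constructor
    · nlinarith
    · by_contra hcon
      nlinarith
  refine ⟨w, hwz, hfl ▸ hfz, ?_⟩
  rw [key, Int.fract, hfl]
  ring

/-! ### Endpoints and the one-point extension -/

/-- The endpoint of the half-lines cut out by the affine form with coefficient `s.1` at the new
variable and remaining data `s.2`. -/
noncomputable def endpoint (α : ℝ) (s : ℤ × (ι → ℤ) × ℤ) (x : ι → ℤ) : ℝ :=
  -fractForm α s.2.1 s.2.2 x / s.1

/-- The data of affine forms with coefficients bounded by `K` and positive leading coefficient. -/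
noncomputable def boundedForms (ι : Type*) [Fintype ι] [DecidableEq ι] (K : ℕ) : Finset (ℤ × (ι → ℤ) × ℤ) :=
  Finset.Icc 1 (K : ℤ) ×ˢ (Fintype.piFinset fun _ => Finset.Icc (-K : ℤ) K) ×ˢ
    Finset.Icc (-K : ℤ) K

theorem mem_boundedForms [DecidableEq ι] {K : ℕ} {s : ℤ × (ι → ℤ) × ℤ} :
    s ∈ boundedForms ι K ↔ (1 ≤ s.1 ∧ s.1 ≤ K) ∧ (∀ i, |s.2.1 i| ≤ K) ∧ |s.2.2| ≤ K := by
  simp [boundedForms, abs_le]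

theorem sign_mul_of_pos {a b : ℝ} (ha : 0 < a) :
    SignType.sign (a * b) = SignType.sign b := by
  rw [sign_mul, sign_pos ha, one_mul]

theorem mul_add_fractForm (s : ℤ × (ι → ℤ) × ℤ) (hs : 1 ≤ s.1) (τ : ℝ) (x : ι → ℤ) :
    s.1 * τ + fractForm α s.2.1 s.2.2 x = s.1 * (τ - endpoint α s x) := by
  have : (s.1 : ℝ) ≠ 0 := by
    have : s.1 ≠ 0 := by omega
    exact_mod_cast this
  rw [endpoint]
  field_simp
  ring

/-- Clearing the positive denominators turns a difference of endpoints into an affine form whose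
coefficients are sums of two products of numbers bounded by `K`; hence the degree `2 * K * K`. -/
theorem FractSim.sign_endpoint_sub [DecidableEq ι] {K m : ℕ} {x y : ι → ℤ}
    (h : FractSim α (2 * K * K) m x y) {s s' : ℤ × (ι → ℤ) × ℤ} (hs : s ∈ boundedForms ι K)
    (hs' : s' ∈ boundedForms ι K) :
    SignType.sign (endpoint α s x - endpoint α s' x) =
      SignType.sign (endpoint α s y - endpoint α s' y) := by
  obtain ⟨⟨h1, h2⟩, h3, h4⟩ := mem_boundedForms.1 hs
  obtain ⟨⟨h1', h2'⟩, h3', h4'⟩ := mem_boundedForms.1 hs'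
  have p1 : (0 : ℝ) < s.1 := by exact_mod_cast h1
  have p2 : (0 : ℝ) < s'.1 := by exact_mod_cast h1'
  have key : ∀ x : ι → ℤ, s.1 * s'.1 * (endpoint α s x - endpoint α s' x) =
      fractForm α (fun i => (-s'.1) * s.2.1 i + s.1 * s'.2.1 i)
        ((-s'.1) * s.2.2 + s.1 * s'.2.2) x := by
    intro x
    rw [fractForm_lin, endpoint, endpoint]
    push_cast
    field_simp
    ring
  have bound : ∀ a b : ℤ, |a| ≤ K → |b| ≤ K → |(-s'.1) * a + s.1 * b| ≤ (2 * K * K : ℕ) := by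
    intro a b ha hb
    have e1 : |s'.1| ≤ K := by rw [abs_of_pos (by omega)]; exact h2'
    have e2 : |s.1| ≤ K := by rw [abs_of_pos (by omega)]; exact h2
    calc |(-s'.1) * a + s.1 * b| ≤ |(-s'.1) * a| + |s.1 * b| := abs_add_le _ _
      _ = |s'.1| * |a| + |s.1| * |b| := by rw [abs_mul, abs_mul, abs_neg]
      _ ≤ K * K + K * K := by gcongr
      _ = (2 * K * K : ℕ) := by push_cast; ring
  rw [← sign_mul_of_pos (mul_pos p1 p2), ← sign_mul_of_pos (mul_pos p1 p2) (b := _ - endpoint α s' y),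
    key, key]
  exact h.sign_eq _ _ (fun i => bound _ _ (h3 i) (h3' i)) (bound _ _ h4 h4')

/-- The sign of a form in one more variable is decided by the side of its endpoint on which that
variable lies; a negative leading coefficient is handled by negating, a zero one by `h`. -/
theorem sign_add_of_sign_sub_endpoint [DecidableEq ι] {K m : ℕ} {x y : ι → ℤ}
    (h : FractSim α K m x y) {σ τ : ℝ}
    (hs : ∀ s ∈ boundedForms ι K, SignType.sign (σ - endpoint α s x) =
      SignType.sign (τ - endpoint α s y))
    {e : ℤ} {c : ι → ℤ} {d : ℤ} (he : |e| ≤ K) (hc : ∀ i, |c i| ≤ K) (hd : |d| ≤ K) :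
    SignType.sign (e * σ + fractForm α c d x) = SignType.sign (e * τ + fractForm α c d y) := by
  have main : ∀ (e : ℤ) (c : ι → ℤ) (d : ℤ), 1 ≤ e → e ≤ K → (∀ i, |c i| ≤ K) → |d| ≤ K →
      SignType.sign (e * σ + fractForm α c d x) = SignType.sign (e * τ + fractForm α c d y) := by
    intro e c d h1 h2 hc hd
    have := hs (e, c, d) (mem_boundedForms.2 ⟨⟨h1, h2⟩, hc, hd⟩)
    have p : (0 : ℝ) < ((e, c, d) : ℤ × (ι → ℤ) × ℤ).1 := by exact_mod_cast h1
    rw [← sign_mul_of_pos p, ← sign_mul_of_pos p (b := τ - _), ← mul_add_fractForm _ h1,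
      ← mul_add_fractForm _ h1] at this
    exact this
  rcases lt_trichotomy e 0 with h0 | rfl | h0
  · rw [abs_of_neg h0] at he
    have := main (-e) (fun i => (-1) * c i + 0 * c i) ((-1) * d + 0 * d) (by omega) he
      (by simpa using hc) (by simpa using hd)
    rw [fractForm_lin, fractForm_lin] at this
    have e1 : ∀ a b : ℝ, ((-e : ℤ) : ℝ) * a + (((-1 : ℤ) : ℝ) * b + ((0 : ℤ) : ℝ) * b) =
        -(e * a + b) := by
      intro a b; push_cast; ring
    rw [e1, e1, Left.sign_neg, Left.sign_neg] at this
    exact neg_injective this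
  · simpa using h.sign_eq c d hc hd
  · exact main e c d h0 (by rwa [abs_of_pos h0] at he) hc hd

/-- A tuple extended by one element. -/
theorem FractSim.exists_extension (hα : Irrational α) {K m : ℕ} (hK : 0 < K) (hm : 0 < m)
    {x y : ι → ℤ} (h : FractSim α (2 * K * K) (K.factorial * m) x y) (z : ℤ) :
    ∃ w : ℤ, z ≡ w [ZMOD m] ∧ ⌊α * z⌋ ≡ ⌊α * w⌋ [ZMOD m] ∧
      ∀ (e : ℤ) (c : ι → ℤ) (d : ℤ), |e| ≤ K → (∀ i, |c i| ≤ K) → |d| ≤ K →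
        SignType.sign (e * Int.fract (α * z) + fractForm α c d x) =
          SignType.sign (e * Int.fract (α * w) + fractForm α c d y) := by
  classical
  have hKK : K ≤ 2 * K * K := by nlinarith
  suffices H : ∃ w : ℤ, z ≡ w [ZMOD m] ∧ ⌊α * z⌋ ≡ ⌊α * w⌋ [ZMOD m] ∧
      ∀ s ∈ boundedForms ι K, SignType.sign (Int.fract (α * z) - endpoint α s x) =
        SignType.sign (Int.fract (α * w) - endpoint α s y) by
    obtain ⟨w, h1, h2, h3⟩ := H
    exact ⟨w, h1, h2, fun e c d he hc hd =>
      sign_add_of_sign_sub_endpoint (h.mono hKK dvd_rfl) h3 he hc hd⟩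
  -- These two forms have endpoints `0` and `1`, so the range of a fractional part is covered by the
  -- comparison of endpoints.
  let zero : ℤ × (ι → ℤ) × ℤ := (1, 0, 0)
  let one : ℤ × (ι → ℤ) × ℤ := (1, 0, -1)
  have hzero : zero ∈ boundedForms ι K := mem_boundedForms.2 (by simp [zero]; omega)
  have hone : one ∈ boundedForms ι K := mem_boundedForms.2 (by simp [one]; omega)
  have ezero : ∀ x, endpoint α zero x = 0 := fun x => by simp [endpoint, zero, fractForm]
  have eone : ∀ x, endpoint α one x = 1 := fun x => by simp [endpoint, one, fractForm]
  have hlt : ∀ s ∈ boundedForms ι K, ∀ s' ∈ boundedForms ι K,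
      (endpoint α s x < endpoint α s' x ↔ endpoint α s y < endpoint α s' y) := by
    intro s hs s' hs'
    have := (sign_eq_iff_lt_and_lt.1 (h.sign_endpoint_sub hs hs')).2
    simpa only [sub_neg] using this
  by_cases hex : ∃ s ∈ boundedForms ι K, Int.fract (α * z) = endpoint α s x
  · obtain ⟨s, hs, hzs⟩ := hex
    obtain ⟨⟨h1, h2⟩, -, -⟩ := mem_boundedForms.1 hs
    have p1 : (0 : ℝ) < s.1 := by exact_mod_cast h1
    -- The factor `K.factorial` makes the modulus divisible by `s.1 * m` for every leading
    -- coefficient that occurs.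
    have hdvd : s.1 * m ∣ ((K.factorial * m : ℕ) : ℤ) := by
      push_cast
      refine mul_dvd_mul_right ?_ _
      lift s.1 to ℕ using by omega with n hn
      exact_mod_cast Nat.dvd_factorial (by omega) (by omega)
    have e0 := mul_add_fractForm (α := α) s h1 0 y
    have e1 := mul_add_fractForm (α := α) s h1 1 y
    have l0 : 0 ≤ endpoint α s y := by
      have := hlt s hs zero hzero
      rw [ezero, ezero, ← hzs] at this
      exact not_lt.1 fun h' => (Int.fract_nonneg (α * z)).not_gt (this.2 h')
    have l1 : endpoint α s y < 1 := by
      have := hlt s hs one hone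
      rw [eone, eone, ← hzs] at this
      exact this.1 (Int.fract_lt_one _)
    obtain ⟨w, hw, hwf, hws⟩ := exists_solution_of_modEq (m := m) hα (show 0 < s.1 by omega)
      (fun i => (h.modEq i).of_dvd hdvd) (fun i => (h.floor_modEq i).of_dvd hdvd)
      (z := z) (c := s.2.1) (d := s.2.2)
      (by rw [mul_add_fractForm s h1, hzs, sub_self, mul_zero]) (by nlinarith) (by nlinarith)
    refine ⟨w, hw, hwf, fun s' hs' => ?_⟩
    have hwe : Int.fract (α * w) = endpoint α s y := by
      rw [mul_add_fractForm s h1] at hws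
      rcases mul_eq_zero.1 hws with h' | h'
      · exact absurd h' p1.ne'
      · linarith
    rw [hzs, hwe]
    exact h.sign_endpoint_sub hs hs'
  · push Not at hex
    let lo := (boundedForms ι K).filter fun s => endpoint α s x < Int.fract (α * z)
    let hi := (boundedForms ι K).filter fun s => Int.fract (α * z) < endpoint α s x
    -- Over `y` the endpoints in `lo` still precede those in `hi`. Choosing `b` between them and
    -- then `a` between `lo` and `b` leaves an open interval, all of whose points are placed like
    -- the fractional part of `α * z`.
    obtain ⟨b, hb1, hb2⟩ := Order.exists_between_finsets (lo.image fun s => endpoint α s y)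
      (hi.image fun s => endpoint α s y) (by
        intro u hu v hv
        simp only [Finset.mem_image, lo, hi, Finset.mem_filter] at hu hv
        obtain ⟨s, ⟨hs, hs1⟩, rfl⟩ := hu
        obtain ⟨s', ⟨hs', hs1'⟩, rfl⟩ := hv
        exact (hlt s hs s' hs').1 (hs1.trans hs1'))
    obtain ⟨a, ha1, ha2⟩ := Order.exists_between_finsets (lo.image fun s => endpoint α s y)
      {b} (by
        intro u hu v hv
        rw [Finset.mem_singleton.1 hv]
        exact hb1 u hu)
    have hab : a < b := ha2 b (Finset.mem_singleton_self b)
    have ha0 : 0 ≤ a := by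
      rw [← ezero y]
      refine (ha1 _ (Finset.mem_image_of_mem _ (Finset.mem_filter.2 ⟨hzero, ?_⟩))).le
      exact lt_of_le_of_ne (by rw [ezero]; exact Int.fract_nonneg _) (hex zero hzero).symm
    have hb1' : b ≤ 1 := by
      rw [← eone y]
      refine (hb2 _ (Finset.mem_image_of_mem _ (Finset.mem_filter.2 ⟨hone, ?_⟩))).le
      rw [eone]; exact Int.fract_lt_one _
    obtain ⟨w, hw, hwf, hwa, hwb⟩ := exists_fract_mem_Ioo hα hm z ha0 hb1' hab
    refine ⟨w, hw.symm, hwf.symm, fun s hs => ?_⟩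
    rcases lt_or_gt_of_ne (hex s hs) with h' | h'
    · have := hb2 _ (Finset.mem_image_of_mem _ (Finset.mem_filter.2 ⟨hs, h'⟩))
      rw [sign_neg (by linarith), sign_neg (by linarith)]
    · have := ha1 _ (Finset.mem_image_of_mem _ (Finset.mem_filter.2 ⟨hs, h'⟩))
      rw [sign_pos (by linarith), sign_pos (by linarith)]

end

/-! ### Formulas depend only on similarity classes -/

section

variable {α : ℝ}

theorem fract_add_eq_sub_ite (a b : ℝ) :
    Int.fract (a + b) = Int.fract a + Int.fract b -
      if Int.fract a + Int.fract b < 1 then 0 else 1 := by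
  have ha := Int.fract_nonneg a
  have hb := Int.fract_nonneg b
  have ha' := Int.fract_lt_one a
  have hb' := Int.fract_lt_one b
  rw [Int.fract_eq_iff]
  split_ifs with h
  · refine ⟨by linarith, by linarith, ⌊a⌋ + ⌊b⌋, ?_⟩
    simp only [Int.fract]; push_cast; ring
  · refine ⟨by linarith, by linarith, ⌊a⌋ + ⌊b⌋ + 1, ?_⟩
    simp only [Int.fract]; push_cast; ring

theorem fractForm_add {ι : Type*} [Fintype ι] (c c' : ι → ℤ) (d d' : ℤ) (x : ι → ℤ) :
    fractForm α (c + c') (d + d') x = fractForm α c d x + fractForm α c' d' x := by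
  simpa [Pi.add_def] using fractForm_lin (α := α) 1 1 c c' d d' x

theorem fractForm_sub {ι : Type*} [Fintype ι] (c c' : ι → ℤ) (d d' : ℤ) (x : ι → ℤ) :
    fractForm α (c - c') (d - d') x = fractForm α c d x - fractForm α c' d' x := by
  simpa [Pi.add_def, Pi.neg_def, sub_eq_add_neg] using fractForm_lin (α := α) 1 (-1) c c' d d' x

theorem exists_abs_le {ι : Type*} [Fintype ι] (c : ι → ℤ) : ∃ N : ℕ, ∀ i, |c i| ≤ N :=
  ⟨∑ i, (c i).natAbs, fun i => by
    rw [Int.abs_eq_natAbs]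
    exact_mod_cast Finset.single_le_sum (f := fun i => (c i).natAbs) (fun _ _ => Nat.zero_le _)
      (Finset.mem_univ i)⟩

theorem fractForm_snoc {ι : Type*} [Fintype ι] {n : ℕ} (c : ι ⊕ Fin (n + 1) → ℤ) (d : ℤ)
    (v : ι → ℤ) (xs : Fin n → ℤ) (z : ℤ) :
    fractForm α c d (Sum.elim v (Fin.snoc xs z : Fin (n + 1) → ℤ)) =
      c (Sum.inr (Fin.last n)) * Int.fract (α * z) +
        fractForm α (Sum.elim (fun i => c (Sum.inl i)) fun i => c (Sum.inr i.castSucc)) d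
          (Sum.elim v xs) := by
  simp [fractForm, Fin.sum_univ_castSucc]
  ring

theorem FractSim.exists_snoc (hα : Irrational α) {K m : ℕ} (hK : 0 < K) (hm : 0 < m)
    {ι : Type*} [Fintype ι] {n : ℕ} {v v' : ι → ℤ} {xs xs' : Fin n → ℤ}
    (h : FractSim α (2 * K * K) (K.factorial * m) (Sum.elim v xs) (Sum.elim v' xs')) (z : ℤ) :
    ∃ w : ℤ, FractSim α K m (Sum.elim v (Fin.snoc xs z : Fin (n + 1) → ℤ))
      (Sum.elim v' (Fin.snoc xs' w : Fin (n + 1) → ℤ)) := by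
  obtain ⟨w, h1, h2, h3⟩ := h.exists_extension hα hK hm z
  have h0 : FractSim α K m (Sum.elim v xs) (Sum.elim v' xs') :=
    h.mono (by nlinarith) (dvd_mul_left _ _)
  refine ⟨w, ⟨?_, ?_, ?_⟩⟩
  · rintro (i | i)
    · exact h0.modEq (Sum.inl i)
    · induction i using Fin.lastCases with
      | last => simpa using h1
      | cast i => simpa using h0.modEq (Sum.inr i)
  · rintro (i | i)
    · exact h0.floor_modEq (Sum.inl i)
    · induction i using Fin.lastCases with
      | last => simpa using h2
      | cast i => simpa using h0.floor_modEq (Sum.inr i)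
  · intro c d hc hd
    rw [fractForm_snoc, fractForm_snoc]
    exact h3 _ _ _ (hc _) (by rintro (i | i) <;> exact hc _) hd

variable [cycGroupLang.Structure ℤ]

open FirstOrder.Language

/-- On similar tuples the fractional part of `α` times a term is given by one affine form. -/
theorem exists_fractForm_term
    (hadd : ∀ v : Fin 2 → ℤ, Structure.funMap (L := cycGroupLang) CycGroupFunc.add v = v 0 + v 1)
    {ι : Type} [Fintype ι] (τ : cycGroupLang.Term ι) :
    ∃ (c : ι → ℤ) (N : ℕ), ∀ m x y, FractSim α N m x y → ∃ d : ℤ, |d| ≤ N ∧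
      Int.fract (α * (τ.realize x : ℤ)) = fractForm α c d x ∧
      Int.fract (α * (τ.realize y : ℤ)) = fractForm α c d y := by
  classical
  induction τ with
  | var i =>
    refine ⟨Pi.single i 1, 0, fun m x y _ => ⟨0, by simp, ?_, ?_⟩⟩ <;>
      simp [fractForm, Pi.single_apply]
  | @func l f ts ih =>
    cases f
    obtain ⟨c₁, N₁, h₁⟩ := ih 0
    obtain ⟨c₂, N₂, h₂⟩ := ih 1
    obtain ⟨B, hB⟩ := exists_abs_le (c₁ + c₂)
    refine ⟨c₁ + c₂, N₁ + N₂ + 1 + B, fun m x y h => ?_⟩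
    obtain ⟨d₁, hd₁, e₁, e₁'⟩ := h₁ m x y (h.mono (by omega) dvd_rfl)
    obtain ⟨d₂, hd₂, e₂, e₂'⟩ := h₂ m x y (h.mono (by omega) dvd_rfl)
    rw [abs_le] at hd₁ hd₂
    -- The sign of this form decides whether the two fractional parts sum to less than `1`, so the
    -- carry is the same at `x` and `y`.
    have hs := h.sign_eq (c₁ + c₂) (d₁ + d₂ - 1) (fun i => (hB i).trans (by push_cast; omega))
      (by rw [abs_le]; push_cast; constructor <;> omega)
    have hfun : ∀ x : ι → ℤ, (Term.func (L := cycGroupLang) CycGroupFunc.add ts).realize x =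
        (ts 0).realize x + (ts 1).realize x := fun x => hadd _
    have hform : ∀ k : ℤ, ∀ x, fractForm α (c₁ + c₂) (d₁ + d₂ - k) x =
        fractForm α c₁ d₁ x + fractForm α c₂ d₂ x - k := by
      intro k x
      rw [← fractForm_add, fractForm, fractForm]
      push_cast; ring
    rw [hform, hform] at hs
    have hlt := (sign_eq_iff_lt_and_lt.1 hs).2
    simp only [Int.cast_one, sub_neg] at hlt
    refine ⟨d₁ + d₂ - if fractForm α c₁ d₁ x + fractForm α c₂ d₂ x < 1 then 0 else 1, ?_, ?_, ?_⟩
    · rw [abs_le]; push_cast; split_ifs <;> constructor <;> omega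
    · rw [hform, hfun]
      push_cast
      rw [mul_add, fract_add_eq_sub_ite, e₁, e₂]
    · rw [hform, hfun]
      push_cast
      rw [mul_add, fract_add_eq_sub_ite, e₁', e₂']
      simp only [hlt]

/-- On similar tuples the fractional parts of `α` times two terms are ordered in the same way. -/
theorem exists_fract_term_lt_iff
    (hadd : ∀ v : Fin 2 → ℤ, Structure.funMap (L := cycGroupLang) CycGroupFunc.add v = v 0 + v 1)
    {ι : Type} [Fintype ι] (τ σ : cycGroupLang.Term ι) :
    ∃ N : ℕ, ∀ m x y, FractSim α N m x y →
      (Int.fract (α * (τ.realize x : ℤ)) < Int.fract (α * (σ.realize x : ℤ)) ↔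
        Int.fract (α * (τ.realize y : ℤ)) < Int.fract (α * (σ.realize y : ℤ))) := by
  obtain ⟨c₁, N₁, h₁⟩ := exists_fractForm_term (α := α) hadd τ
  obtain ⟨c₂, N₂, h₂⟩ := exists_fractForm_term (α := α) hadd σ
  obtain ⟨B, hB⟩ := exists_abs_le (c₁ - c₂)
  refine ⟨N₁ + N₂ + B, fun m x y h => ?_⟩
  obtain ⟨d₁, hd₁, e₁, e₁'⟩ := h₁ m x y (h.mono (by omega) dvd_rfl)
  obtain ⟨d₂, hd₂, e₂, e₂'⟩ := h₂ m x y (h.mono (by omega) dvd_rfl)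
  rw [abs_le] at hd₁ hd₂
  have hs := h.sign_eq (c₁ - c₂) (d₁ - d₂) (fun i => (hB i).trans (by push_cast; omega))
      (by rw [abs_le]; push_cast; constructor <;> omega)
  rw [fractForm_sub, fractForm_sub] at hs
  rw [e₁, e₂, e₁', e₂']
  simpa only [sub_neg] using (sign_eq_iff_lt_and_lt.1 hs).2

/-- Formulas do not distinguish tuples that are similar to a sufficiently high degree. -/
theorem exists_fractSim_realize_iff (hα : Irrational α)
    (hadd : ∀ v : Fin 2 → ℤ, Structure.funMap (L := cycGroupLang) CycGroupFunc.add v = v 0 + v 1)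
    (hcyc : ∀ v : Fin 3 → ℤ, Structure.RelMap (L := cycGroupLang) CycGroupRel.cyc v ↔
      cyclicOrderOf α (v 0) (v 1) (v 2))
    {ι : Type} [Fintype ι] {n : ℕ} (φ : cycGroupLang.BoundedFormula ι n) :
    ∃ K m : ℕ, 0 < K ∧ 0 < m ∧ ∀ (v v' : ι → ℤ) (xs xs' : Fin n → ℤ),
      FractSim α K m (Sum.elim v xs) (Sum.elim v' xs') → (φ.Realize v xs ↔ φ.Realize v' xs') := by
  induction φ with
  | falsum => exact ⟨1, 1, one_pos, one_pos, fun _ _ _ _ _ => Iff.rfl⟩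
  | equal τ σ =>
    obtain ⟨N₁, h₁⟩ := exists_fract_term_lt_iff (α := α) hadd τ σ
    obtain ⟨N₂, h₂⟩ := exists_fract_term_lt_iff (α := α) hadd σ τ
    refine ⟨N₁ + N₂ + 1, 1, by omega, one_pos, fun v v' xs xs' h => ?_⟩
    -- By irrationality, equality too reduces to the order of fractional parts.
    have e : ∀ a b : ℤ, a = b ↔
        ¬ Int.fract (α * a) < Int.fract (α * b) ∧ ¬ Int.fract (α * b) < Int.fract (α * a) := by
      intro a b
      constructor
      · rintro rfl; simp
      · rintro ⟨h1, h2⟩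
        exact fract_mul_intCast_injective hα (le_antisymm (not_lt.1 h2) (not_lt.1 h1))
    simp only [BoundedFormula.Realize]
    rw [e, e, h₁ 1 _ _ (h.mono (by omega) dvd_rfl), h₂ 1 _ _ (h.mono (by omega) dvd_rfl)]
  | rel R ts =>
    cases R
    obtain ⟨N₁, h₁⟩ := exists_fract_term_lt_iff (α := α) hadd (ts 0) (ts 1)
    obtain ⟨N₂, h₂⟩ := exists_fract_term_lt_iff (α := α) hadd (ts 1) (ts 2)
    obtain ⟨N₃, h₃⟩ := exists_fract_term_lt_iff (α := α) hadd (ts 2) (ts 0)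
    refine ⟨N₁ + N₂ + N₃ + 1, 1, by omega, one_pos, fun v v' xs xs' h => ?_⟩
    simp only [BoundedFormula.Realize]
    refine (hcyc _).trans (Iff.trans ?_ (hcyc _).symm)
    simp only [cyclicOrderOf, circleCyclic]
    rw [h₁ 1 _ _ (h.mono (by omega) dvd_rfl), h₂ 1 _ _ (h.mono (by omega) dvd_rfl),
      h₃ 1 _ _ (h.mono (by omega) dvd_rfl)]
  | imp φ ψ ihφ ihψ =>
    obtain ⟨K₁, m₁, hK₁, hm₁, h₁⟩ := ihφ
    obtain ⟨K₂, m₂, hK₂, hm₂, h₂⟩ := ihψ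
    refine ⟨K₁ + K₂, m₁ * m₂, by omega, by positivity, fun v v' xs xs' h => ?_⟩
    rw [BoundedFormula.realize_imp, BoundedFormula.realize_imp,
      h₁ _ _ _ _ (h.mono (by omega) (dvd_mul_right _ _)),
      h₂ _ _ _ _ (h.mono (by omega) (dvd_mul_left _ _))]
  | all φ ih =>
    obtain ⟨K, m, hK, hm, ih⟩ := ih
    refine ⟨2 * K * K, K.factorial * m, by positivity, by positivity, ?_⟩
    have key : ∀ (v v' : ι → ℤ) (xs xs' : Fin _ → ℤ),
        FractSim α (2 * K * K) (K.factorial * m) (Sum.elim v xs) (Sum.elim v' xs') →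
        φ.all.Realize v xs → φ.all.Realize v' xs' := by
      intro v v' xs xs' h hr w
      obtain ⟨z, hz⟩ := h.symm.exists_snoc hα hK hm w
      exact (ih _ _ _ _ hz).2 (hr z)
    exact fun v v' xs xs' h => ⟨key _ _ _ _ h, key _ _ _ _ h.symm⟩

end

/-! ### Counting the cells cut out by finitely many points -/

/-- The position of `t` relative to the points of `E`. -/
noncomputable def positionIn (E : Finset ℝ) (t : ℝ) : ℕ :=
  (E.filter (· < t)).card + (E.filter (· ≤ t)).card

theorem positionIn_lt (E : Finset ℝ) (t : ℝ) : positionIn E t < 2 * E.card + 1 := by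
  have h1 := Finset.card_filter_le E (· < t)
  have h2 := Finset.card_filter_le E (· ≤ t)
  rw [positionIn]
  omega

/-- Both counts in `positionIn` are monotone in the point, so equal sums force each count, and then
each filtered set, to agree. -/
theorem lt_iff_and_le_iff_of_positionIn_eq {E : Finset ℝ} {s t : ℝ}
    (h : positionIn E s = positionIn E t) : ∀ e ∈ E, (e < s ↔ e < t) ∧ (e ≤ s ↔ e ≤ t) := by
  wlog hst : s ≤ t generalizing s t
  · exact fun e he => (this h.symm (le_of_not_ge hst) e he).imp Iff.symm Iff.symm
  have s1 : E.filter (· < s) ⊆ E.filter (· < t) :=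
    Finset.monotone_filter_right _ fun _ _ h => h.trans_le hst
  have s2 : E.filter (· ≤ s) ⊆ E.filter (· ≤ t) :=
    Finset.monotone_filter_right _ fun _ _ h => h.trans hst
  have c1 := Finset.card_le_card s1
  have c2 := Finset.card_le_card s2
  simp only [positionIn] at h
  have e1 := Finset.eq_of_subset_of_card_le s1 (by omega)
  have e2 := Finset.eq_of_subset_of_card_le s2 (by omega)
  intro e he
  have f1 := Finset.ext_iff.1 e1 e
  have f2 := Finset.ext_iff.1 e2 e
  simp only [Finset.mem_filter, he, true_and] at f1 f2
  exact ⟨f1, f2⟩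

/-- The set `R` is, on each colour class of `κ`, the trace under `f` of a subset of the line
with boundary in `E`. -/
def HasBoundary {X F : Type*} (κ : X → F) (f : X → ℝ) (E : Finset ℝ) (R : X → Prop) : Prop :=
  ∀ x x', κ x = κ x' → (∀ e ∈ E, (e < f x ↔ e < f x') ∧ (e ≤ f x ↔ e ≤ f x')) → (R x ↔ R x')

/-- Sets with few boundary points do not form large grids. -/
theorem sq_le_of_hasBoundary {X F : Type*} [Fintype F] {κ : X → F} {f : X → ℝ} {M n : ℕ}
    {R S : Fin n → X → Prop} {E E' : Fin n → Finset ℝ} (hE : ∀ i, (E i).card ≤ M)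
    (hE' : ∀ i, (E' i).card ≤ M) (hR : ∀ i, HasBoundary κ f (E i) (R i))
    (hS : ∀ i, HasBoundary κ f (E' i) (S i)) (x : Fin n → Fin n → X)
    (hx : ∀ i j k, R k (x i j) ↔ k = i) (hx' : ∀ i j k, S k (x i j) ↔ k = j) :
    n * n ≤ Fintype.card F * (4 * n * M + 1) := by
  classical
  let T : Finset ℝ := Finset.univ.biUnion E ∪ Finset.univ.biUnion E'
  have hT : T.card ≤ 2 * n * M := by
    have h1 := Finset.card_biUnion_le_card_mul Finset.univ E M fun i _ => hE i
    have h2 := Finset.card_biUnion_le_card_mul Finset.univ E' M fun i _ => hE' i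
    rw [Finset.card_univ, Fintype.card_fin] at h1 h2
    calc T.card ≤ _ := Finset.card_union_le _ _
      _ ≤ n * M + n * M := add_le_add h1 h2
      _ = 2 * n * M := by ring
  -- Colour and cell determine the grid point: `R i` and `S j` are constant on each such class, and
  -- `R i` holds only in row `i`, `S j` only in column `j`.
  let g : Fin n × Fin n → F × Fin (2 * T.card + 1) := fun p =>
    (κ (x p.1 p.2), ⟨positionIn T (f (x p.1 p.2)), positionIn_lt _ _⟩)
  have hg : Function.Injective g := by
    rintro ⟨i, j⟩ ⟨i', j'⟩ h
    simp only [g, Prod.mk.injEq, Fin.mk.injEq] at h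
    obtain ⟨hκ, hp⟩ := h
    have hp := lt_iff_and_le_iff_of_positionIn_eq hp
    have r := (hR i _ _ hκ fun e he => hp e (Finset.mem_union_left _
      (Finset.mem_biUnion.2 ⟨i, Finset.mem_univ _, he⟩))).1 ((hx i j i).2 rfl)
    have s := (hS j _ _ hκ fun e he => hp e (Finset.mem_union_right _
      (Finset.mem_biUnion.2 ⟨j, Finset.mem_univ _, he⟩))).1 ((hx' i j j).2 rfl)
    rw [(hx i' j' i).1 r, (hx' i' j' j).1 s]
  have hc := Fintype.card_le_of_injective g hg
  simp only [Fintype.card_prod, Fintype.card_fin] at hc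
  refine hc.trans (Nat.mul_le_mul_left _ ?_)
  calc 2 * T.card + 1 ≤ 2 * (2 * n * M) + 1 := by gcongr
    _ = 4 * n * M + 1 := by ring

/-! ### Dp-minimality -/

section

open FirstOrder.Language

theorem FractSim.refl (α : ℝ) {ι : Type*} [Fintype ι] (N m : ℕ) (x : ι → ℤ) :
    FractSim α N m x x :=
  ⟨fun _ => Int.ModEq.refl _, fun _ => Int.ModEq.refl _, fun _ _ _ _ => rfl⟩

/-- The residues of `x` and of the integral part of `α * x` modulo `m`. -/
noncomputable def residues (α : ℝ) (m : ℕ) (x : ℤ) : ZMod m × ZMod m :=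
  (x, ⌊α * x⌋)

/-- The instances of a formula in one variable have boundaries of bounded size. -/
theorem exists_hasBoundary_realize {α : ℝ} (hα : Irrational α) [cycGroupLang.Structure ℤ]
    (hadd : ∀ v : Fin 2 → ℤ, Structure.funMap (L := cycGroupLang) CycGroupFunc.add v = v 0 + v 1)
    (hcyc : ∀ v : Fin 3 → ℤ, Structure.RelMap (L := cycGroupLang) CycGroupRel.cyc v ↔
      cyclicOrderOf α (v 0) (v 1) (v 2))
    {k : ℕ} (φ : cycGroupLang.Formula (Unit ⊕ Fin k)) :
    ∃ m M : ℕ, 0 < m ∧ ∀ m', m ∣ m' → ∀ a : Fin k → ℤ, ∃ E : Finset ℝ, E.card ≤ M ∧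
      HasBoundary (residues α m') (fun x : ℤ => Int.fract (α * x)) E
        (fun x => φ.Realize (Sum.elim (fun _ => x) a)) := by
  obtain ⟨K, m, hK, hm, h⟩ := exists_fractSim_realize_iff hα hadd hcyc φ
  -- The endpoints move with `a`, but their number is bounded by the number of forms, which depends
  -- only on the formula.
  refine ⟨m, (boundedForms (Fin k) K).card, hm, fun m' hm' a =>
    ⟨(boundedForms (Fin k) K).image fun s => endpoint α s a, Finset.card_image_le, ?_⟩⟩
  intro x x' hκ hE
  rw [residues, residues, Prod.mk.injEq, ZMod.intCast_eq_intCast_iff,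
    ZMod.intCast_eq_intCast_iff] at hκ
  have hdvd : (m : ℤ) ∣ m' := Int.natCast_dvd_natCast.2 hm'
  refine h _ _ _ _ ⟨?_, ?_, ?_⟩
  · rintro ((_ | i) | i)
    · exact hκ.1.of_dvd hdvd
    · rfl
    · exact i.elim0
  · rintro ((_ | i) | i)
    · exact hκ.2.of_dvd hdvd
    · rfl
    · exact i.elim0
  · intro c d hc hd
    have key : ∀ (x : ℤ) (e : Fin 0 → ℤ), fractForm α c d
          (Sum.elim (Sum.elim (fun _ => x) a) e) =
        c (Sum.inl (Sum.inl ())) * Int.fract (α * x) +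
          fractForm α (fun i => c (Sum.inl (Sum.inr i))) d a := by
      intro x e
      simp [fractForm]
      ring
    rw [key, key]
    refine sign_add_of_sign_sub_endpoint (FractSim.refl α K 1 a) (fun s hs => ?_) (hc _)
      (fun i => hc _) hd
    obtain ⟨h1, h2⟩ := hE _ (Finset.mem_image_of_mem _ hs)
    rw [sign_eq_iff_lt_and_lt, sub_pos, sub_pos, sub_neg, sub_neg]
    exact ⟨h1, by simpa only [not_le] using not_congr h2⟩

/-- The formulas `φ` and `ψ` form a grid of size `n` in `N`. -/
def HasFiniteIctPattern {L : FirstOrder.Language} (N : Type*) [L.Structure N] {m m' : ℕ}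
    (φ : L.Formula (Unit ⊕ Fin m)) (ψ : L.Formula (Unit ⊕ Fin m')) (n : ℕ) : Prop :=
  ∃ (a : Fin n → Fin m → N) (b : Fin n → Fin m' → N), ∀ i j, ∃ x : N,
    (∀ k, φ.Realize (Sum.elim (fun _ => x) (a k)) ↔ k = i) ∧
    (∀ k, ψ.Realize (Sum.elim (fun _ => x) (b k)) ↔ k = j)

theorem HasIctPattern.hasFiniteIctPattern {L : FirstOrder.Language} {N : Type*} [L.Structure N]
    {m m' : ℕ} {φ : L.Formula (Unit ⊕ Fin m)} {ψ : L.Formula (Unit ⊕ Fin m')}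
    (h : HasIctPattern N φ ψ) (n : ℕ) : HasFiniteIctPattern N φ ψ n := by
  obtain ⟨a, b, h⟩ := h
  refine ⟨fun k => a k, fun k => b k, fun i j => ?_⟩
  obtain ⟨x, h1, h2⟩ := h i j
  exact ⟨x, fun k => (h1 k).trans Fin.ext_iff.symm, fun k => (h2 k).trans Fin.ext_iff.symm⟩

/-- The existence of a finite grid is expressed by a sentence. -/
theorem exists_sentence_hasFiniteIctPattern {L : FirstOrder.Language} {m m' : ℕ}
    (φ : L.Formula (Unit ⊕ Fin m)) (ψ : L.Formula (Unit ⊕ Fin m')) (n : ℕ) :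
    ∃ σ : L.Sentence, ∀ (N : Type) [L.Structure N], N ⊨ σ ↔ HasFiniteIctPattern N φ ψ n := by
  classical
  let γ := (Fin n × Fin m) ⊕ (Fin n × Fin m')
  let φ' : Fin n → L.Formula ((Empty ⊕ γ) ⊕ Unit) := fun k =>
    φ.relabel (Sum.elim (fun u => Sum.inr u) fun l => Sum.inl (Sum.inr (Sum.inl (k, l))))
  let ψ' : Fin n → L.Formula ((Empty ⊕ γ) ⊕ Unit) := fun k =>
    ψ.relabel (Sum.elim (fun u => Sum.inr u) fun l => Sum.inl (Sum.inr (Sum.inr (k, l))))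
  let χ : Fin n × Fin n → L.Formula (Empty ⊕ γ) := fun p =>
    Formula.iExs Unit
      ((Formula.iInf fun k => if k = p.1 then φ' k else (φ' k).not) ⊓
        (Formula.iInf fun k => if k = p.2 then ψ' k else (ψ' k).not))
  refine ⟨Formula.iExs γ (Formula.iInf χ), fun N _ => ?_⟩
  have hφ : ∀ k (u : Empty → N) (c : γ → N) (x : Unit → N),
      (φ' k).Realize (Sum.elim (Sum.elim u c) x) ↔
        φ.Realize (Sum.elim (fun _ => x ()) fun l => c (Sum.inl (k, l))) := by
    intro k u c x
    rw [Formula.realize_relabel]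
    congr! 1
    funext s
    rcases s with s | s <;> rfl
  have hψ : ∀ k (u : Empty → N) (c : γ → N) (x : Unit → N),
      (ψ' k).Realize (Sum.elim (Sum.elim u c) x) ↔
        ψ.Realize (Sum.elim (fun _ => x ()) fun l => c (Sum.inr (k, l))) := by
    intro k u c x
    rw [Formula.realize_relabel]
    congr! 1
    funext s
    rcases s with s | s <;> rfl
  have hite : ∀ (p : Prop) [Decidable p] (θ : L.Formula ((Empty ⊕ γ) ⊕ Unit)) (v : _ → N),
      (if p then θ else θ.not).Realize v ↔ (θ.Realize v ↔ p) := by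
    intro p _ θ v
    split_ifs with hp <;> simp [hp]
  rw [Sentence.Realize, Formula.realize_iExs]
  simp only [Formula.realize_iInf, χ, Formula.realize_iExs, Formula.realize_inf, hite, hφ, hψ]
  constructor
  · rintro ⟨c, hc⟩
    refine ⟨fun k l => c (Sum.inl (k, l)), fun k l => c (Sum.inr (k, l)), fun i j => ?_⟩
    obtain ⟨x, hx⟩ := hc (i, j)
    exact ⟨x (), hx⟩
  · rintro ⟨a, b, h⟩
    refine ⟨Sum.elim (fun p => a p.1 p.2) fun p => b p.1 p.2, fun p => ?_⟩
    obtain ⟨x, hx⟩ := h p.1 p.2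
    exact ⟨fun _ => x, hx⟩

theorem isDPMinimal_intCycTheory {α : ℝ} (hα : Irrational α) :
    IsDPMinimal (intCycTheory (cyclicOrderOf α)) := by
  let _ := intCycStructure (cyclicOrderOf α)
  intro N _ hN k l φ ψ hpat
  change N ⊨ cycGroupLang.completeTheory ℤ at hN
  obtain ⟨m₁, M₁, hm₁, h₁⟩ := exists_hasBoundary_realize hα (fun _ => rfl) (fun _ => Iff.rfl) φ
  obtain ⟨m₂, M₂, hm₂, h₂⟩ := exists_hasBoundary_realize hα (fun _ => rfl) (fun _ => Iff.rfl) ψ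
  have : NeZero (m₁ * m₂) := ⟨by positivity⟩
  -- With `F` colours and `M = M₁ + M₂`, this `n` gives `F * (4 * n * M + 1) ≤ n * (n - 1) < n * n`,
  -- against `sq_le_of_hasBoundary`.
  let n := Fintype.card (ZMod (m₁ * m₂) × ZMod (m₁ * m₂)) * (4 * (M₁ + M₂) + 1) + 1
  obtain ⟨σ, hσ⟩ := exists_sentence_hasFiniteIctPattern φ ψ n
  obtain ⟨a, b, hab⟩ := (hσ ℤ).1 ((realize_iff_of_model_completeTheory ℤ N σ).1
    ((hσ N).2 (hpat.hasFiniteIctPattern n)))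
  choose E hE hE' using fun i => h₁ _ (dvd_mul_right m₁ m₂) (a i)
  choose E₂ hE₂ hE₂' using fun i => h₂ _ (dvd_mul_left m₂ m₁) (b i)
  choose x hx hx' using hab
  have hle := sq_le_of_hasBoundary (M := M₁ + M₂) (fun i => (hE i).trans (by omega))
    (fun i => (hE₂ i).trans (by omega)) hE' hE₂' x hx hx'
  set F := Fintype.card (ZMod (m₁ * m₂) × ZMod (m₁ * m₂))
  have hn : 1 ≤ n := by omega
  have : F * (4 * n * (M₁ + M₂) + 1) ≤ n * (F * (4 * (M₁ + M₂) + 1)) := by nlinarith [Nat.zero_le F]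
  have hn' : n = F * (4 * (M₁ + M₂) + 1) + 1 := rfl
  nlinarith

end

/-! ### The cyclic order axioms -/

theorem isAdditiveCyclicOrder_cyclicOrderOf {α : ℝ} (hα : Irrational α) :
    IsAdditiveCyclicOrder (cyclicOrderOf α) where
  cyclic a b c h := by
    simp only [cyclicOrderOf, circleCyclic] at *
    tauto
  asymm a b c h := by
    simp only [cyclicOrderOf, circleCyclic] at *
    rintro (h' | h' | h') <;> rcases h with h | h | h <;> linarith [h.1, h.2, h'.1, h'.2]
  trans a b c d h h' := by
    simp only [cyclicOrderOf, circleCyclic] at *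
    rcases h with h | h | h <;> rcases h' with h' | h' | h' <;>
      first
      | exact Or.inl ⟨by linarith [h.1, h.2, h'.1, h'.2], by linarith [h.1, h.2, h'.1, h'.2]⟩
      | exact Or.inr (Or.inl
          ⟨by linarith [h.1, h.2, h'.1, h'.2], by linarith [h.1, h.2, h'.1, h'.2]⟩)
      | exact Or.inr (Or.inr
          ⟨by linarith [h.1, h.2, h'.1, h'.2], by linarith [h.1, h.2, h'.1, h'.2]⟩)
  total a b c hab hbc hac := by
    have h1 := fun h => hab (fract_mul_intCast_injective hα h)
    have h2 := fun h => hbc (fract_mul_intCast_injective hα h)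
    have h3 := fun h => hac (fract_mul_intCast_injective hα h)
    simp only [cyclicOrderOf, circleCyclic]
    rcases lt_or_gt_of_ne h1 with h1 | h1 <;> rcases lt_or_gt_of_ne h2 with h2 | h2 <;>
      rcases lt_or_gt_of_ne h3 with h3 | h3 <;> simp [h1, h2, h3]
  add_right a b c g h := by
    have ha := Int.fract_nonneg (α * a)
    have hb := Int.fract_nonneg (α * b)
    have hc := Int.fract_nonneg (α * c)
    have hg := Int.fract_nonneg (α * g)
    have ha' := Int.fract_lt_one (α * a)
    have hb' := Int.fract_lt_one (α * b)
    have hc' := Int.fract_lt_one (α * c)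
    have hg' := Int.fract_lt_one (α * g)
    simp only [cyclicOrderOf, circleCyclic] at *
    push_cast
    simp only [mul_add, fract_add_eq_sub_ite]
    split_ifs <;> rcases h with h | h | h <;>
      first
      | exact Or.inl ⟨by linarith [h.1, h.2], by linarith [h.1, h.2]⟩
      | exact Or.inr (Or.inl ⟨by linarith [h.1, h.2], by linarith [h.1, h.2]⟩)
      | exact Or.inr (Or.inr ⟨by linarith [h.1, h.2], by linarith [h.1, h.2]⟩)

/-! ### Recovering `α` from a definable set -/

/-- The integers `x` for which `x`, `2 * x`, `3 * x` (equivalently `0`, `x`, `2 * x`) are positively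
oriented. -/
def doublingSet (α : ℝ) : Set ℤ :=
  {x | cyclicOrderOf α x (x + x) (x + x + x)}

theorem fract_two_mul (a : ℝ) :
    Int.fract (2 * a) = 2 * Int.fract a - if Int.fract a < 1 / 2 then 0 else 1 := by
  rw [two_mul, fract_add_eq_sub_ite, ← two_mul]
  congr 2
  rw [eq_iff_iff]
  constructor <;> intro <;> linarith

theorem mem_doublingSet {α : ℝ} (hα : Irrational α) {x : ℤ} (hx : x ≠ 0) :
    x ∈ doublingSet α ↔ Int.fract (α * x) < 1 / 2 := by
  have hirr := hα.mul_intCast hx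
  have h0 := Int.fract_nonneg (α * x)
  have h1 := Int.fract_lt_one (α * x)
  have hne : Int.fract (α * x) ≠ 0 := fun h => by
    have := Int.floor_add_fract (α * x)
    rw [h, add_zero] at this
    exact hirr.ne_int _ this.symm
  have hpos := lt_of_le_of_ne h0 hne.symm
  have hadd : ∀ g : ℤ, cyclicOrderOf α (0 + g) (x + g) (x + x + g) ↔
      cyclicOrderOf α 0 x (x + x) := fun g => by
    refine ⟨fun h => ?_, (isAdditiveCyclicOrder_cyclicOrderOf hα).add_right _ _ _ g⟩
    simpa using (isAdditiveCyclicOrder_cyclicOrderOf hα).add_right _ _ _ (-g) h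
  -- Translation by `x` replaces `x, 2x, 3x` by `0, x, 2x`; the former triple is the one expressible
  -- without a symbol for zero.
  have key := hadd x
  rw [zero_add] at key
  refine key.trans ?_
  simp only [cyclicOrderOf, circleCyclic]
  have e : α * ((x + x : ℤ) : ℝ) = 2 * (α * x) := by push_cast; ring
  rw [e, fract_two_mul]
  simp only [Int.cast_zero, mul_zero, Int.fract_zero]
  split_ifs with h
  · simp only [h, iff_true]
    left
    constructor <;> linarith
  · simp only [h, iff_false]
    rintro (h' | h' | h') <;> linarith [h'.1, h'.2]

/-- The set `doublingSet α` determines the binary digits of `α`. -/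
theorem eq_of_doublingSet_eq {α β : ℝ} (hα : Irrational α) (hβ : Irrational β)
    (hα' : α ∈ Set.Ico (0 : ℝ) 1) (hβ' : β ∈ Set.Ico (0 : ℝ) 1)
    (h : doublingSet α = doublingSet β) : α = β := by
  -- Equal binary digits make doubling act on the difference without a carry. The left side stays
  -- below `1` in absolute value, while the right side is unbounded unless `α = β`.
  have key : ∀ k : ℕ, Int.fract (α * (2 ^ k : ℤ)) - Int.fract (β * (2 ^ k : ℤ)) =
      2 ^ k * (α - β) := by
    intro k
    induction k with
    | zero => simp [Int.fract_eq_self.2 hα', Int.fract_eq_self.2 hβ']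
    | succ k ih =>
      have hd : Int.fract (α * ((2 ^ k : ℤ) : ℝ)) < 1 / 2 ↔
          Int.fract (β * ((2 ^ k : ℤ) : ℝ)) < 1 / 2 := by
        rw [← mem_doublingSet hα (by positivity), ← mem_doublingSet hβ (by positivity), h]
      have e : ∀ a : ℝ, a * ((2 ^ (k + 1) : ℤ) : ℝ) = 2 * (a * ((2 ^ k : ℤ) : ℝ)) := by
        intro a; push_cast; ring
      push_cast at ih hd e ⊢
      rw [e, e, fract_two_mul, fract_two_mul, pow_succ]
      simp only [hd]
      linear_combination 2 * ih
  by_contra hne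
  have hpos : 0 < |α - β| := abs_pos.2 (sub_ne_zero.2 hne)
  obtain ⟨k, hk⟩ := pow_unbounded_of_one_lt (1 / |α - β|) (one_lt_two (α := ℝ))
  rw [div_lt_iff₀ hpos] at hk
  have := congrArg abs (key k)
  rw [abs_mul, abs_of_pos (by positivity : (0 : ℝ) < 2 ^ k)] at this
  have hlt : |Int.fract (α * (2 ^ k : ℤ)) - Int.fract (β * (2 ^ k : ℤ))| < 1 := by
    rw [abs_lt]
    constructor <;> linarith [Int.fract_nonneg (α * (2 ^ k : ℤ)), Int.fract_lt_one (α * (2 ^ k : ℤ)),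
      Int.fract_nonneg (β * (2 ^ k : ℤ)), Int.fract_lt_one (β * (2 ^ k : ℤ))]
  linarith

open FirstOrder.Language

theorem doublingSet_mem_definableSubsets (α : ℝ) :
    doublingSet α ∈ definableSubsets (cyclicOrderOf α) := by
  let _ := intCycStructure (cyclicOrderOf α)
  let x : cycGroupLang.Term (Fin 1 ⊕ Fin 0) := Term.var (Sum.inl 0)
  let plus : cycGroupLang.Functions 2 := CycGroupFunc.add
  let rel : cycGroupLang.Relations 3 := CycGroupRel.cyc
  let xx := plus.apply₂ x x
  let φ : cycGroupLang.Formula (Fin 1) :=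
    BoundedFormula.rel rel ![x, xx, plus.apply₂ xx x]
  change (Set.univ : Set ℤ).Definable cycGroupLang {v : Fin 1 → ℤ | v 0 ∈ doublingSet α}
  refine Set.Definable.mono (Set.empty_definable_iff.2 ⟨φ, ?_⟩) (Set.empty_subset _)
  ext v
  rfl

/-! ### Countability and the choice of `A` -/

instance countable_sigma_functions_cycGroupLang : Countable (Σ l, cycGroupLang.Functions l) := by
  refine Function.Injective.countable (f := fun _ => (0 : ℕ)) ?_
  rintro ⟨_, ⟨⟩⟩ ⟨_, ⟨⟩⟩ -
  rfl

instance countable_sigma_relations_cycGroupLang : Countable (Σ l, cycGroupLang.Relations l) := by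
  refine Function.Injective.countable (f := fun _ => (0 : ℕ)) ?_
  rintro ⟨_, ⟨⟩⟩ ⟨_, ⟨⟩⟩ -
  rfl

theorem countable_definableSubsets (C : ℤ → ℤ → ℤ → Prop) : (definableSubsets C).Countable := by
  let _ := intCycStructure C
  have hcard : #(Σ n, cycGroupLang.BoundedFormula ((Set.univ : Set ℤ) ⊕ Fin 1) n) ≤ ℵ₀ := by
    refine BoundedFormula.card_le.trans (max_le le_rfl ?_)
    simp only [card, Cardinal.add_le_aleph0, Cardinal.lift_le_aleph0, Cardinal.mk_le_aleph0_iff]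
    refine ⟨inferInstance, ?_⟩
    unfold Symbols
    infer_instance
  have hc : Countable (Σ n, cycGroupLang.BoundedFormula ((Set.univ : Set ℤ) ⊕ Fin 1) n) :=
    Cardinal.mk_le_aleph0_iff.1 hcard
  have hc' : Countable (cycGroupLang.Formula ((Set.univ : Set ℤ) ⊕ Fin 1)) :=
    Function.Injective.countable (f := fun φ =>
      (⟨0, φ⟩ : Σ n, cycGroupLang.BoundedFormula ((Set.univ : Set ℤ) ⊕ Fin 1) n))
      fun φ ψ h => by simpa using h
  refine (Set.countable_range fun φ : cycGroupLang.Formula ((Set.univ : Set ℤ) ⊕ Fin 1) =>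
    {z : ℤ | φ.Realize (Sum.elim (fun a => (a : ℤ)) fun _ => z)}).mono ?_
  intro X hX
  obtain ⟨φ, hφ⟩ := Set.definable_iff_exists_formula_sum.1
    (show (Set.univ : Set ℤ).Definable cycGroupLang {v : Fin 1 → ℤ | v 0 ∈ X} from hX)
  refine ⟨φ, ?_⟩
  ext z
  exact (Set.ext_iff.1 hφ fun _ => z).symm

theorem DefinablyEquivalent.definableSubsets_eq {C C' : ℤ → ℤ → ℤ → Prop}
    (h : DefinablyEquivalent C C') : definableSubsets C = definableSubsets C' := by
  ext X
  exact ⟨h.1 1 {v | v 0 ∈ X}, h.2 1 {v | v 0 ∈ X}⟩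

/-- The irrational numbers of the unit interval. -/
def unitIrrationals : Set ℝ :=
  {α | Irrational α ∧ α ∈ Set.Ico (0 : ℝ) 1}

theorem mk_unitIrrationals : #unitIrrationals = 𝔠 := by
  have h : unitIrrationals = Set.Ico (0 : ℝ) 1 \ Set.range ((↑) : ℚ → ℝ) := by
    ext α
    simp only [unitIrrationals, Irrational, Set.mem_ofPred_eq, Set.mem_sdiff]
    tauto
  have hle := Cardinal.le_mk_sdiff_add_mk (Set.Ico (0 : ℝ) 1) (Set.range ((↑) : ℚ → ℝ))
  rw [← h, Cardinal.mk_Ico_real zero_lt_one] at hle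
  refine le_antisymm ((Cardinal.mk_set_le _).trans Cardinal.mk_real.le) ?_
  by_contra hlt
  refine hle.not_gt (Cardinal.add_lt_of_lt Cardinal.aleph0_le_continuum (not_le.1 hlt) ?_)
  exact (Set.countable_range _).le_aleph0.trans_lt Cardinal.aleph0_lt_continuum

theorem corollary3p7 :
    ∃ A : Set ℝ, #A = 𝔠 ∧ (∀ α ∈ A, Irrational α) ∧
      (∀ α ∈ A, IsAdditiveCyclicOrder (cyclicOrderOf α)) ∧
      (∀ α ∈ A, IsDPMinimal (intCycTheory (cyclicOrderOf α))) ∧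
      (∀ α ∈ A, ∀ β ∈ A, α ≠ β →
        ¬ DefinablyEquivalent (cyclicOrderOf α) (cyclicOrderOf β) ∧
        definableSubsets (cyclicOrderOf α) ≠ definableSubsets (cyclicOrderOf β)) := by
  let D : ℝ → Set (Set ℤ) := fun α => definableSubsets (cyclicOrderOf α)
  -- `A` contains exactly one representative for each value of `D` on `unitIrrationals`.
  obtain ⟨A, hAI, hAD⟩ := Set.SurjOn.exists_bijOn_subset (Set.surjOn_image D unitIrrationals)
  have hirr : ∀ α ∈ A, Irrational α := fun α hα => (hAI hα).1
  have hfib : ∀ d : D '' unitIrrationals,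
      #((fun α : unitIrrationals => (⟨D α, Set.mem_image_of_mem D α.2⟩ :
        D '' unitIrrationals)) ⁻¹' {d}) ≤ ℵ₀ := by
    rintro ⟨_, γ, hγ, rfl⟩
    have hc : Countable (D γ) := (countable_definableSubsets (cyclicOrderOf γ)).to_subtype
    -- The fibre over `D γ` injects into the countable set `D γ` by `α ↦ doublingSet α`.
    refine Cardinal.mk_le_aleph0_iff.2 (Function.Injective.countable (β := D γ)
      (f := fun α => ⟨doublingSet α.1, ?_⟩) ?_)
    · have h1 : D α.1 = D γ := congrArg Subtype.val α.2
      exact h1.subset (doublingSet_mem_definableSubsets α.1)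
    · intro α β hαβ
      exact Subtype.ext (Subtype.ext (eq_of_doublingSet_eq α.1.2.1 β.1.2.1 α.1.2.2 β.1.2.2
        (congrArg Subtype.val hαβ)))
  -- Countable fibres give `𝔠 ≤ #A * ℵ₀` once `#A` is identified with the cardinality of the image,
  -- so `#A < 𝔠` is impossible.
  have hle := Cardinal.mk_le_mk_mul_of_mk_preimage_le _ hfib
  have hne : ∀ α ∈ A, ∀ β ∈ A, α ≠ β → D α ≠ D β := fun α hα β hβ h h' => h (hAD.injOn hα hβ h')
  refine ⟨A, ?_, hirr, fun α hα => isAdditiveCyclicOrder_cyclicOrderOf (hirr α hα),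
    fun α hα => isDPMinimal_intCycTheory (hirr α hα), fun α hα β hβ h =>
      ⟨fun h' => hne α hα β hβ h h'.definableSubsets_eq, hne α hα β hβ h⟩⟩
  have hA : #A = #(D '' unitIrrationals) := Cardinal.mk_congr (hAD.equiv D)
  rw [mk_unitIrrationals, ← hA] at hle
  refine le_antisymm ((Cardinal.mk_set_le A).trans Cardinal.mk_real.le) ?_
  by_contra hlt
  exact hle.not_gt (Cardinal.mul_lt_of_lt Cardinal.aleph0_le_continuum (not_le.1 hlt)
    Cardinal.aleph0_lt_continuum)
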